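/- Conventions. A simplicial tree is a (non-empty) one-dimensional simplicial complex whose underlying graph is connected and has no cycles (a single vertex is allowed), equipped with the path metric in which every edge is isometric to $[0,1]$. It is countable if it has countably many vertices, and locally finite if every vertex has finitely many neighbours. For $L\geqslant 1$, $C\geqslant 0$, a map $f:X\to Y$ of metric spaces is an $(L,C)$-quasi-isometry if $\frac1L d_X(x_1,x_2)-C\leqslant d_Y(f(x_1),f(x_2))\leqslant L\,d_X(x_1,x_2)+C$ for all $x_1,x_2\in X$, and for every $y\in Y$ there is $x\in X$ with $d_Y(f(x),y)\leqslant C$. A map $A:G\times X\to X$ is an $(L,C)$-quasi-action of a group $G$ on a metric space $X$ if $A(g,-)$ is an $(L,C)$-quasi-isometry for every $g\in G$ and $d(A(g,A(h,x)),A(gh,x))\leqslant C$ for all $g,h\in G$, $x\in X$. It is cobounded if there is $K\geqslant 0$ such that for all $x,y\in X$ there is $g\in G$ with $d(A(g,x),y)\leqslant K$. Quasi-actions $A_X$ on $X$ and $A_Y$ on $Y$ of the same group $G$ are quasi-conjugate if there are a map $f:X\to Y$ that is a quasi-isometry (for some constants) and a constant $K\geqslant 0$ with $d_Y(f(A_X(g,x)),A_Y(g,f(x)))\leqslant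 K$ for all $g\in G$, $x\in X$. Corollary. Let $G$ be a finitely generated group. (1) If $A$ is a cobounded $(L,C)$-quasi-action of $G$ on a countable simplicial tree, for some $L\geqslant 1$, $C\geqslant 0$, then there are $C'\geqslant 0$ and a $(1,C')$-quasi-action of $G$ on a countable simplicial tree that is quasi-conjugate to $A$. (2) If $A$ is a cobounded $(L,C)$-quasi-action of $G$ on a locally finite simplicial tree, for some $L\geqslant 1$, $C\geqslant 0$, then there are $C'\geqslant 0$ and a $(1,C')$-quasi-action of $G$ on a locally finite simplicial tree that is quasi-conjugate to $A$. -/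

import Mathlib

universe u w

/-- A simplicial tree, presented combinatorially: a one-dimensional (abstract) simplicial complex
is a simple graph, and it is a tree when it is non-empty, connected and without cycles.  A single
vertex is allowed.  There is no restriction on the number of neighbours of a vertex. -/
structure SimplicialTree : Type (u + 1) where
  /-- the vertices -/
  V : Type u
  /-- the edges -/
  graph : SimpleGraph V
  isTree : graph.IsTree

namespace SimplicialTree

/-- The simplicial tree has countably many vertices. -/
def IsCountable (T : SimplicialTree.{u}) : Prop := Countable T.V

/-- Every vertex has finitely many neighbours. -/
def IsLocallyFinite (T : SimplicialTree.{u}) : Prop :=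
  ∀ v : T.V, (T.graph.neighborSet v).Finite

/-- The points of the geometric realization, in barycentric coordinates: finitely supported
functions on the vertices with non-negative values of sum `1`, supported in a single vertex
or in the two ends of an edge. -/
@[ext]
structure Point (T : SimplicialTree.{u}) : Type u where
  coord : T.V →₀ ℝ
  nonneg : ∀ w, 0 ≤ coord w
  sum_eq_one : (coord.sum fun _ a => a) = 1
  mem_cell : ∃ u v, (u = v ∨ T.graph.Adj u v) ∧ ∀ w, coord w ≠ 0 → w = u ∨ w = v

/-- `p` lies on the closed edge between `u` and `v`. -/
def OnEdge (T : SimplicialTree.{u}) (u v : T.V) (p : T.Point) : Prop :=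
  T.graph.Adj u v ∧ ∀ w, p.coord w ≠ 0 → w = u ∨ w = v

/-- `T.HasPath p q ℓ`: there is a path of length `ℓ` from `p` to `q` that is a finite concatenation
of segments, each contained in a closed edge.  The edge between `u` and `v` is identified with
`[0, 1]` by the coordinate at `u`, so that a segment in it from `p` to `q` has length
`|p u - q u|`. -/
inductive HasPath (T : SimplicialTree.{u}) : T.Point → T.Point → ℝ → Prop
  | nil (p : T.Point) : HasPath T p p 0
  | cons {p q r : T.Point} {u v : T.V} {l : ℝ} (hp : T.OnEdge u v p) (hq : T.OnEdge u v q)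
      (h : HasPath T q r l) : HasPath T p r (|p.coord u - q.coord u| + l)

/-- The path metric: the infimum of the lengths of the paths between two points. -/
noncomputable def pathDist (T : SimplicialTree.{u}) (p q : T.Point) : ℝ :=
  sInf {l : ℝ | T.HasPath p q l}

variable {T : SimplicialTree.{u}}

theorem OnEdge.add_eq_one {u v : T.V} {p : T.Point} (h : T.OnEdge u v p) :
    p.coord u + p.coord v = 1 := by
  classical
  have hs : p.coord.support ⊆ {u, v} := by
    intro w hw
    simpa using h.2 w (Finsupp.mem_support_iff.1 hw)
  have h1 := p.sum_eq_one
  rwa [Finsupp.sum_of_support_subset _ hs _ (by simp), Finset.sum_pair h.1.ne] at h1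

/-- A segment in an edge has length at least the change of any coordinate. -/
theorem OnEdge.abs_sub_le {u v : T.V} {p q : T.Point} (hp : T.OnEdge u v p) (hq : T.OnEdge u v q)
    (w : T.V) : |p.coord w - q.coord w| ≤ |p.coord u - q.coord u| := by
  by_cases hu : w = u
  · rw [hu]
  by_cases hv : w = v
  · have h1 := hp.add_eq_one
    have h2 := hq.add_eq_one
    rw [hv, show p.coord v - q.coord v = -(p.coord u - q.coord u) by linarith, abs_neg]
  · have h1 : p.coord w = 0 := by
      by_contra h
      rcases hp.2 w h with h | h <;> contradiction
    have h2 : q.coord w = 0 := by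
      by_contra h
      rcases hq.2 w h with h | h <;> contradiction
    simp [h1, h2]

theorem HasPath.abs_sub_le {p q : T.Point} {l : ℝ} (h : T.HasPath p q l) (w : T.V) :
    |p.coord w - q.coord w| ≤ l := by
  induction h with
  | nil p => simp
  | cons hp hq _ ih =>
    exact (_root_.abs_sub_le _ _ _).trans (add_le_add (hp.abs_sub_le hq w) ih)

theorem HasPath.trans {p q r : T.Point} {l m : ℝ} (h : T.HasPath p q l) (h' : T.HasPath q r m) :
    T.HasPath p r (l + m) := by
  induction h with
  | nil p => simpa using h'
  | cons hp hq _ ih =>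
    rw [add_assoc]
    exact .cons hp hq (ih h')

theorem HasPath.symm {p q : T.Point} {l : ℝ} (h : T.HasPath p q l) : T.HasPath q p l := by
  induction h with
  | nil p => exact .nil p
  | cons hp hq _ ih =>
    have := ih.trans (.cons hq hp (.nil _))
    rwa [add_zero, abs_sub_comm, add_comm] at this

theorem HasPath.nonneg {p q : T.Point} {l : ℝ} (h : T.HasPath p q l) : 0 ≤ l := by
  induction h with
  | nil p => exact le_rfl
  | cons _ _ _ ih => positivity

/-- A vertex as a point of the realization. -/
noncomputable def vertex (T : SimplicialTree.{u}) (v : T.V) : T.Point where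
  coord := Finsupp.single v 1
  nonneg w := by
    classical
    rw [Finsupp.single_apply]
    split_ifs <;> norm_num
  sum_eq_one := by simp
  mem_cell := ⟨v, v, Or.inl rfl, fun w hw => by
    classical
    rw [Finsupp.single_apply] at hw
    by_contra h
    exact hw (if_neg fun h' => h (Or.inl h'.symm))⟩

theorem onEdge_vertex_left {u v : T.V} (h : T.graph.Adj u v) : T.OnEdge u v (T.vertex u) := by
  classical
  refine ⟨h, fun w hw => ?_⟩
  by_contra h'
  exact hw ((Finsupp.single_apply).trans (if_neg fun h'' => h' (Or.inl h''.symm)))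

theorem OnEdge.swap {u v : T.V} {p : T.Point} (h : T.OnEdge u v p) : T.OnEdge v u p :=
  ⟨h.1.symm, fun w hw => (h.2 w hw).symm⟩

theorem exists_hasPath_vertex {u v : T.V} (h : T.graph.Walk u v) :
    ∃ l, T.HasPath (T.vertex u) (T.vertex v) l := by
  induction h with
  | nil => exact ⟨_, .nil _⟩
  | cons h _ ih =>
    obtain ⟨l, hl⟩ := ih
    exact ⟨_, .cons (onEdge_vertex_left h) (onEdge_vertex_left h.symm).swap hl⟩

theorem exists_hasPath_to_vertex (p : T.Point) : ∃ v l, T.HasPath p (T.vertex v) l := by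
  classical
  obtain ⟨u, v, huv | huv, h⟩ := p.mem_cell
  · subst huv
    have hs : p.coord.support ⊆ {u} := by
      intro w hw
      simpa using h w (Finsupp.mem_support_iff.1 hw)
    have h1 := p.sum_eq_one
    rw [Finsupp.sum_of_support_subset _ hs _ (by simp), Finset.sum_singleton] at h1
    have hp : p = T.vertex u := by
      ext w
      change p.coord w = Finsupp.single u 1 w
      rw [Finsupp.single_apply]
      split_ifs with hw
      · rw [← hw, h1]
      · by_contra h'
        rcases h w h' with h | h <;> exact hw h.symm
    exact ⟨u, 0, hp ▸ .nil _⟩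
  · exact ⟨u, _, .cons ⟨huv, h⟩ (onEdge_vertex_left huv) (.nil _)⟩

theorem exists_hasPath (p q : T.Point) : ∃ l, T.HasPath p q l := by
  obtain ⟨u, l, hl⟩ := exists_hasPath_to_vertex p
  obtain ⟨v, m, hm⟩ := exists_hasPath_to_vertex q
  obtain ⟨w⟩ := T.isTree.connected.preconnected u v
  obtain ⟨k, hk⟩ := exists_hasPath_vertex w
  exact ⟨_, hl.trans (hk.trans hm.symm)⟩

theorem pathDist_le {p q : T.Point} {l : ℝ} (h : T.HasPath p q l) : T.pathDist p q ≤ l :=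
  csInf_le ⟨0, fun _ h => HasPath.nonneg h⟩ h

theorem le_pathDist {p q : T.Point} {b : ℝ} (h : ∀ l, T.HasPath p q l → b ≤ l) :
    b ≤ T.pathDist p q :=
  le_csInf (exists_hasPath p q) h

/-- The geometric realization of a simplicial tree, with the path metric. -/
noncomputable instance : MetricSpace T.Point where
  dist := T.pathDist
  dist_self p := le_antisymm (pathDist_le (.nil p)) (le_pathDist fun _ h => h.nonneg)
  dist_comm p q := le_antisymm (le_pathDist fun _ h => pathDist_le h.symm)
    (le_pathDist fun _ h => pathDist_le h.symm)
  dist_triangle p q r := by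
    rw [← sub_le_iff_le_add]
    refine le_pathDist fun l hl => ?_
    rw [sub_le_comm]
    refine le_pathDist fun m hm => ?_
    rw [sub_le_iff_le_add']
    exact pathDist_le (hl.trans hm)
  eq_of_dist_eq_zero {p q} h := by
    ext w
    have h1 : |p.coord w - q.coord w| ≤ T.pathDist p q := le_pathDist fun _ h => h.abs_sub_le w
    exact sub_eq_zero.1 (abs_nonpos_iff.1 (h1.trans_eq h))

end SimplicialTree

/-- `f` is an `(L, C)`-quasi-isometry. -/
structure IsQuasiIsometry {X : Type*} {Y : Type*} [MetricSpace X] [MetricSpace Y]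
    (L C : ℝ) (f : X → Y) : Prop where
  one_le : 1 ≤ L
  nonneg : 0 ≤ C
  lower : ∀ x₁ x₂ : X, 1 / L * dist x₁ x₂ - C ≤ dist (f x₁) (f x₂)
  upper : ∀ x₁ x₂ : X, dist (f x₁) (f x₂) ≤ L * dist x₁ x₂ + C
  coarselySurjective : ∀ y : Y, ∃ x : X, dist (f x) y ≤ C

/-- `A` is an `(L, C)`-quasi-action of the group `G` on `X`. -/
structure IsQuasiAction {G : Type*} {X : Type*} [Group G] [MetricSpace X]
    (L C : ℝ) (A : G → X → X) : Prop where
  isQuasiIsometry : ∀ g : G, IsQuasiIsometry L C (A g)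
  almost_mul : ∀ (g h : G) (x : X), dist (A g (A h x)) (A (g * h) x) ≤ C

/-- Coboundedness of a quasi-action. -/
def IsCobounded {G : Type*} {X : Type*} [MetricSpace X] (A : G → X → X) : Prop :=
  ∃ C : ℝ, 0 ≤ C ∧ ∀ x y : X, ∃ g : G, dist (A g x) y ≤ C

/-- Coarse equivariance of a map with respect to two quasi-actions. -/
def IsCoarselyEquivariant {G : Type*} {X : Type*} {Y : Type*} [MetricSpace Y]
    (A : G → X → X) (B : G → Y → Y) (f : X → Y) : Prop :=
  ∃ C : ℝ, 0 ≤ C ∧ ∀ (x : X) (g : G), dist (f (A g x)) (B g (f x)) ≤ C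

/-- Two quasi-actions are quasi-conjugate if there is a coarsely equivariant quasi-isometry. -/
def AreQuasiConjugate {G : Type*} {X : Type*} {Y : Type*} [MetricSpace X] [MetricSpace Y]
    (A : G → X → X) (B : G → Y → Y) : Prop :=
  ∃ f : X → Y, (∃ L C : ℝ, IsQuasiIsometry L C f) ∧ IsCoarselyEquivariant A B f

/-! The quasi-action is replaced by a genuine isometric action on another space, and that space is
shown to be a tree up to an additive error. Fix a vertex `x₀` and join `g` and `h` in a graph `Γ` on
`G` when `A (g⁻¹ * h) x₀` or `A (h⁻¹ * g) x₀` is near `x₀`. Left translation preserves `Γ`, and by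
coboundedness the orbit map from `Γ` to the tree is a quasi-isometry.

The multiplicative constant disappears because a graph quasi-isometric to a tree differs from some
tree by an additive constant only (`exists_tree_of_coarse_map`). The new tree consists of the
components of the complements of balls around a base point, cut along spheres
(`exists_tree_of_levels`). The additive error is the diameter of such a piece, bounded by means of
medians in the original tree. A piece is determined by its level and one vertex of the original
tree, whence countability and local finiteness.

The new tree depends on the base point, so `G` does not act on it. But left translation of `G`,
carried over by a rough isometry, gives a quasi-action with multiplicative constant 1
(`isQuasiAction_of_leftInvariant`), and the orbit map provides the quasi-conjugacy
(`areQuasiConjugate_of_leftInvariant`). -/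

namespace SimpleGraph

/-! ### Separating vertices and medians. -/

variable {V : Type*} {G : SimpleGraph V}

/-- Every walk from `a` to `b` visits `m`. -/
def Separates (G : SimpleGraph V) (m a b : V) : Prop := ∀ w : G.Walk a b, m ∈ w.support

theorem Separates.symm {m a b : V} (h : G.Separates m a b) : G.Separates m b a := fun w => by
  simpa using h w.reverse

theorem separates_left (a b : V) : G.Separates a a b := fun w => w.start_mem_support

theorem IsAcyclic.separates (hG : G.IsAcyclic) {m a b : V} {p : G.Walk a b} (hp : p.IsPath)
    (hm : m ∈ p.support) : G.Separates m a b := fun w => by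
  classical
  have h := (hG.subsingleton_path a b).elim ⟨p, hp⟩ w.toPath
  exact w.support_toPath_subset_support (h ▸ hm)

/-- If some walk from `o` to `p` avoids the neighbour `o'` of `o`, and `o'` separates `p` from `q`,
then `o` separates `p` from `q`. -/
theorem IsAcyclic.separates_of_adj (hG : G.IsAcyclic) {o o' p q : V} (h : G.Adj o o')
    (w : G.Walk o p) (hw : o' ∉ w.support) (hs : G.Separates o' p q) : G.Separates o p q := by
  classical
  -- The path from `o'` to `p` starts through `o`. A walk from `p` to `q` must reach `o'`, and its
  -- part up to there already meets `o`.
  have hp : (Walk.cons h.symm w.bypass).IsPath :=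
    w.bypass_isPath.cons fun h' => hw (w.support_bypass_subset_support h')
  have h1 : G.Separates o p o' := (hG.separates hp (by simp)).symm
  intro v
  exact v.support_takeUntil_subset_support (hs v) (h1 _)

/-- Move `o` along a walk to `p`. A median for the neighbour `o'` still serves for `o`, unless some
walk from `o` to `p` or `q` avoids it; then it equals `o'`, and `o` itself is a median. -/
theorem IsAcyclic.exists_median (hG : G.IsAcyclic) {o p : V} (w : G.Walk o p) (q : V) :
    ∃ m, G.Separates m o p ∧ G.Separates m o q ∧ G.Separates m p q := by
  induction w with
  | nil => exact ⟨_, separates_left _ _, separates_left _ _, separates_left _ _⟩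
  | @cons o o' p h w ih =>
    obtain ⟨m, h1, h2, h3⟩ := ih
    have key : ∀ r, G.Separates m o' r → ∀ v : G.Walk o r, m ∉ v.support → m = o' := by
      intro r hr v hv
      have := hr (Walk.cons h.symm v)
      rw [Walk.support_cons, List.mem_cons] at this
      exact this.resolve_right hv
    by_cases hp : G.Separates m o p
    · by_cases hq : G.Separates m o q
      · exact ⟨m, hp, hq, h3⟩
      · simp only [Separates, not_forall] at hq
        obtain ⟨v, hv⟩ := hq
        obtain rfl := key q h2 v hv
        exact ⟨o, separates_left _ _, separates_left _ _,
          (hG.separates_of_adj h v hv h3.symm).symm⟩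
    · simp only [Separates, not_forall] at hp
      obtain ⟨v, hv⟩ := hp
      obtain rfl := key p h1 v hv
      exact ⟨o, separates_left _ _, separates_left _ _, hG.separates_of_adj h v hv h3⟩

/-- A coarse path between the two sides of a separating vertex passes near that vertex. -/
theorem Separates.exists_dist_le (hG : G.Connected) {X : Type*} {Γ : SimpleGraph X} {ψ : X → V}
    {E : ℕ} (hψ : ∀ x y, Γ.Adj x y → G.dist (ψ x) (ψ y) ≤ E) {m : V} {x y : X} (w : Γ.Walk x y)
    (h : G.Separates m (ψ x) (ψ y)) : ∃ z ∈ w.support, G.dist (ψ z) m ≤ E := by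
  classical
  induction w with
  | @nil a =>
    have := h .nil
    simp only [Walk.support_nil, List.mem_singleton] at this
    exact ⟨a, by simp, by simp [this]⟩
  | @cons x x' y hx w ih =>
    obtain ⟨p, hp⟩ := hG.exists_walk_length_eq_dist (ψ x) (ψ x')
    by_cases hm : m ∈ p.support
    · refine ⟨x, by simp, ?_⟩
      exact (dist_le (p.takeUntil m hm)).trans
        ((p.length_takeUntil_le_length hm).trans (hp.trans_le (hψ _ _ hx)))
    · obtain ⟨z, hz, hz'⟩ := ih fun v => by
        have := h (p.append v)
        rw [Walk.mem_support_append_iff] at this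
        exact this.resolve_left hm
      exact ⟨z, by simp [hz], hz'⟩

theorem Walk.dist_add_dist_of_mem_support (hG : G.Connected) {a b z : V} (p : G.Walk a b)
    (hp : p.length = G.dist a b) (hz : z ∈ p.support) :
    G.dist a z + G.dist z b = G.dist a b := by
  classical
  have h1 := dist_le (p.takeUntil z hz)
  have h2 := dist_le (p.dropUntil z hz)
  have h3 := congrArg Walk.length (p.take_spec hz)
  rw [Walk.length_append] at h3
  have h4 := hG.dist_triangle (u := a) (v := z) (w := b)
  omega

/-- Choose a point of `X` near each vertex of `p`; consecutive choices have images within `K + 1 +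
K`. The extra edge joins the last choice to the prescribed end `y`. -/
theorem exists_walk_of_coarselyDense {X : Type*} {Γ : SimpleGraph X} {ψ : X → V}
    (hG : G.Connected) {K : ℕ} (hK : ∀ v, ∃ x, G.dist (ψ x) v ≤ K)
    (hΓ : ∀ x y, G.dist (ψ x) (ψ y) ≤ 2 * K + 1 → x = y ∨ Γ.Adj x y) {v v' : V}
    (p : G.Walk v v') : ∀ x y, G.dist (ψ x) v ≤ K → G.dist (ψ y) v' ≤ K →
      ∃ w : Γ.Walk x y, w.length ≤ p.length + 1 := by
  induction p with
  | nil =>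
    intro x y hx hy
    rw [dist_comm] at hy
    have := hG.dist_triangle (u := ψ x) (v := _) (w := ψ y) |>.trans (add_le_add hx hy)
    obtain rfl | h := hΓ x y (by omega)
    · exact ⟨.nil, by simp⟩
    · exact ⟨.cons h .nil, by simp⟩
  | @cons v v₁ v' h p ih =>
    intro x y hx hy
    obtain ⟨z, hz⟩ := hK v₁
    obtain ⟨w, hw⟩ := ih z y hz hy
    have h1 : G.dist v v₁ = 1 := dist_eq_one_iff_adj.2 h
    have h2 := hG.dist_triangle (u := ψ x) (v := v) (w := ψ z)
    have h3 := hG.dist_triangle (u := v) (v := v₁) (w := ψ z)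
    rw [dist_comm (u := v₁)] at h3
    obtain rfl | h := hΓ x z (by omega)
    · exact ⟨w, by simp; omega⟩
    · exact ⟨.cons h w, by simp; omega⟩

theorem connected_and_dist_le {X : Type*} [Nonempty X] {Γ : SimpleGraph X} {ψ : X → V}
    (hG : G.Connected) {K : ℕ} (hK : ∀ v, ∃ x, G.dist (ψ x) v ≤ K)
    (hΓ : ∀ x y, G.dist (ψ x) (ψ y) ≤ 2 * K + 1 → x = y ∨ Γ.Adj x y) :
    Γ.Connected ∧ ∀ x y, Γ.dist x y ≤ G.dist (ψ x) (ψ y) + 1 := by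
  have hwalk : ∀ x y, ∃ w : Γ.Walk x y, w.length ≤ G.dist (ψ x) (ψ y) + 1 := fun x y => by
    obtain ⟨p, hp⟩ := hG.exists_walk_length_eq_dist (ψ x) (ψ y)
    obtain ⟨w, hw⟩ := exists_walk_of_coarselyDense hG hK hΓ p x y (by simp) (by simp)
    exact ⟨w, hp ▸ hw⟩
  refine ⟨⟨fun x y => ⟨(hwalk x y).choose⟩⟩, fun x y => ?_⟩
  obtain ⟨w, hw⟩ := hwalk x y
  exact (dist_le w).trans hw

theorem dist_le_mul_dist {X : Type*} {Γ : SimpleGraph X} {ψ : X → V} (hG : G.Connected)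
    (hΓ : Γ.Connected) {E : ℕ} (hψ : ∀ x y, Γ.Adj x y → G.dist (ψ x) (ψ y) ≤ E) (x y : X) :
    G.dist (ψ x) (ψ y) ≤ E * Γ.dist x y := by
  obtain ⟨w, hw⟩ := hΓ.exists_walk_length_eq_dist x y
  rw [← hw]
  clear hw
  induction w with
  | nil => simp
  | @cons x x' y h w ih =>
    have := hG.dist_triangle (u := ψ x) (v := ψ x') (w := ψ y)
    have := hψ _ _ h
    rw [Walk.length_cons, mul_add, mul_one]
    omega

theorem finite_dist_le (hG : G.Connected) (hf : ∀ v, (G.neighborSet v).Finite) (v : V) (n : ℕ) :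
    {a | G.dist v a ≤ n}.Finite := by
  induction n generalizing v with
  | zero =>
    refine (Set.finite_singleton v).subset fun a ha => ?_
    exact ((hG.dist_eq_zero_iff).1 (Nat.le_zero.1 ha)).symm
  | succ n ih =>
    refine ((Set.finite_singleton v).union ((hf v).biUnion fun a _ => ih a)).subset fun a ha => ?_
    obtain ⟨p, hp⟩ := hG.exists_walk_length_eq_dist v a
    cases p with
    | nil => exact Or.inl rfl
    | @cons _ b _ h p =>
      refine Or.inr (Set.mem_biUnion h ?_)
      have := dist_le p
      rw [Walk.length_cons] at hp
      simp only [Set.mem_ofPred_eq] at ha ⊢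
      omega

/-- The graph of a parent function. -/
theorem isTree_fromRel_parent {Q : Type*} (ℓ : Q → ℕ) (par : Q → Q) (root : Q)
    (hroot : ∀ q, ℓ q = 0 → q = root) (hpar : ∀ q, ℓ q ≠ 0 → ℓ (par q) + 1 = ℓ q)
    (hpr : ∀ q, ℓ q = 0 → par q = q) :
    (fromRel fun a b => par a = b).IsTree := by
  set H := fromRel fun a b => par a = b with hH
  have hle : ∀ q, ℓ (par q) ≤ ℓ q := fun q => by
    by_cases h : ℓ q = 0
    · rw [hpr q h]
    · have := hpar q h
      omega
  have hiter : ∀ k q, ℓ (par^[k] q) ≤ ℓ q := by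
    intro k
    induction k with
    | zero => simp
    | succ k ih => exact fun q => (ih _).trans (hle q)
  have hreach : ∀ n q, ℓ q = n → H.Reachable q root := by
    intro n
    induction n with
    | zero => exact fun q hq => hroot q hq ▸ .rfl
    | succ n ih =>
      intro q hq
      have h1 := hpar q (by omega)
      have h2 : H.Adj q (par q) := by
        rw [hH, fromRel_adj]
        exact ⟨fun h => by rw [← h] at h1; omega, Or.inl rfl⟩
      exact h2.reachable.trans (ih _ (by omega))
  have hbridge : ∀ q, q ≠ par q → H.IsBridge s(q, par q) := by
    intro q hq
    rw [isBridge_iff]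
    rintro ⟨w⟩
    -- Without the edge from `q` to its parent, a walk cannot leave the set of descendants of `q`;
    -- `par q` is not one of them, since `ℓ` does not increase along `par`.
    have hinv : ∀ x y, (H.deleteEdges {s(q, par q)}).Walk x y → (∃ k, par^[k] x = q) →
        ∃ k, par^[k] y = q := by
      intro x y w
      induction w with
      | nil => exact id
      | @cons a b c h w ih =>
        rintro ⟨k, hk⟩
        refine ih ?_
        rw [deleteEdges_adj, hH, fromRel_adj] at h
        obtain ⟨⟨hne, hab | hab⟩, he⟩ := h
        · cases k with
          | zero =>
            simp only [Function.iterate_zero, id] at hk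
            subst hk
            subst hab
            simp at he
          | succ k =>
            rw [Function.iterate_succ_apply, hab] at hk
            exact ⟨k, hk⟩
        · exact ⟨k + 1, by rw [Function.iterate_succ_apply, hab, hk]⟩
    obtain ⟨k, hk⟩ := hinv _ _ w ⟨0, rfl⟩
    by_cases h0 : ℓ q = 0
    · exact hq (hpr q h0).symm
    · have h1 := hpar q h0
      have h2 := hiter k (par q)
      rw [hk] at h2
      omega
  refine ⟨@Connected.mk _ _ (fun a b => (hreach _ a rfl).trans (hreach _ b rfl).symm) ⟨root⟩, ?_⟩
  rw [isAcyclic_iff_forall_adj_isBridge]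
  intro a b h
  rw [hH, fromRel_adj] at h
  obtain ⟨hne, rfl | rfl⟩ := h
  · exact hbridge a hne
  · rw [Sym2.eq_swap]
    exact hbridge b hne.symm

end SimpleGraph

/-! ### The tree of components outside balls. -/

namespace SimpleGraph

variable {X : Type*} (Γ : SimpleGraph X) (b : X)

/-- The subgraph on the vertices at distance at least `n` from `b`. -/
def outside (n : ℕ) : SimpleGraph X where
  Adj x y := Γ.Adj x y ∧ n ≤ Γ.dist b x ∧ n ≤ Γ.dist b y
  symm := ⟨fun _ _ h => ⟨h.1.symm, h.2.2, h.2.1⟩⟩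
  loopless := ⟨fun _ h => Γ.irrefl h.1⟩

theorem outside_anti {m n : ℕ} (h : m ≤ n) : Γ.outside b n ≤ Γ.outside b m :=
  fun _ _ h' => ⟨h'.1, h.trans h'.2.1, h.trans h'.2.2⟩

theorem le_dist_of_mem_support_outside {n : ℕ} {x y : X} (w : (Γ.outside b n).Walk x y)
    (hx : n ≤ Γ.dist b x) {z : X} (hz : z ∈ w.support) : n ≤ Γ.dist b z := by
  induction w with
  | nil =>
    rw [Walk.support_nil, List.mem_singleton] at hz
    rwa [hz]
  | cons h w ih =>
    rw [Walk.support_cons, List.mem_cons] at hz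
    obtain rfl | hz := hz
    · exact hx
    · exact ih h.2.2 hz

/-- Two vertices on the same sphere around `b`, in the same component outside of the open ball. -/
def levelSetoid : Setoid X where
  r x y := Γ.dist b x = Γ.dist b y ∧ (Γ.outside b (Γ.dist b x)).Reachable x y
  iseqv :=
    { refl := fun _ => ⟨rfl, .rfl⟩
      symm := fun h => ⟨h.1.symm, h.1 ▸ h.2.symm⟩
      trans := fun h h' => ⟨h.1.trans h'.1, h.2.trans (h.1 ▸ h'.2)⟩ }

variable {Γ b}

theorem Connected.exists_parent (hΓ : Γ.Connected) (x : X) :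
    ∃ y, (Γ.dist b x = 0 ∧ y = x) ∨ (Γ.Adj x y ∧ Γ.dist b y + 1 = Γ.dist b x) := by
  obtain ⟨p, hp⟩ := hΓ.exists_walk_length_eq_dist x b
  cases p with
  | nil => exact ⟨b, Or.inl ⟨by simp, rfl⟩⟩
  | @cons _ y _ h p =>
    refine ⟨y, Or.inr ⟨h, ?_⟩⟩
    rw [dist_comm (u := b) (v := x), dist_comm]
    have h1 := dist_le p
    have h2 := hΓ.dist_triangle (u := x) (v := y) (w := b)
    rw [dist_eq_one_iff_adj.2 h] at h2
    rw [Walk.length_cons] at hp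
    omega

theorem Connected.exists_ancestor (hΓ : Γ.Connected) {n : ℕ} (k : ℕ) (x : X)
    (hx : Γ.dist b x = n + k) :
    ∃ y, Γ.dist b y = n ∧ Γ.dist x y ≤ k ∧ (Γ.outside b n).Reachable x y := by
  induction k generalizing x with
  | zero => exact ⟨x, hx, by simp, .rfl⟩
  | succ k ih =>
    obtain ⟨y, h | h⟩ := hΓ.exists_parent (b := b) x
    · omega
    · obtain ⟨z, h1, h2, h3⟩ := ih y (by omega)
      refine ⟨z, h1, ?_, ?_⟩
      · have := hΓ.dist_triangle (u := x) (v := y) (w := z)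
        rw [dist_eq_one_iff_adj.2 h.1] at this
        omega
      · have : (Γ.outside b n).Adj x y := ⟨h.1, by omega, by omega⟩
        exact this.reachable.trans h3

/-- The components of the complements of balls form a tree, which approximates the graph up to an
additive constant when these components meet the spheres in sets of bounded diameter. -/
theorem Connected.exists_tree_of_levels (hΓ : Γ.Connected) {D : ℕ}
    (hD : ∀ x y, Γ.dist b x = Γ.dist b y → (Γ.outside b (Γ.dist b x)).Reachable x y →
      Γ.dist x y ≤ D)
    {Q : Type*} (π : X → Q) (hπ : Function.Surjective π)
    (hr : ∀ x y, π x = π y ↔ Γ.levelSetoid b x y) :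
    ∃ H : SimpleGraph Q, H.IsTree ∧ (∀ x y, H.dist (π x) (π y) ≤ Γ.dist x y) ∧
      ∀ x y, Γ.dist x y ≤ H.dist (π x) (π y) + D := by
  choose par hpar using hΓ.exists_parent (b := b)
  obtain ⟨σ, hσ⟩ := hπ.hasRightInverse
  have hadj : ∀ x y, Γ.Adj x y → Γ.dist b x = Γ.dist b y → π x = π y := fun x y h h' =>
    (hr x y).2 ⟨h', Adj.reachable ⟨h, le_rfl, h'.le⟩⟩
  -- The parent of a class is well defined: a walk from `x` to `z` outside the ball, prolonged by
  -- one step down at both ends, stays outside the ball of radius one less.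
  have hparent : ∀ x y z, π x = π z → Γ.Adj x y → Γ.dist b y + 1 = Γ.dist b x →
      π (par z) = π y := by
    intro x y z hxz hxy hd
    obtain ⟨h1, h2⟩ := (hr x z).1 hxz
    rcases hpar z with h | h
    · omega
    refine ((hr _ _).2 ⟨by omega, ?_⟩).symm
    have h3 : (Γ.outside b (Γ.dist b y)).Adj y x := ⟨hxy.symm, by omega, by omega⟩
    have h4 : (Γ.outside b (Γ.dist b y)).Adj z (par z) := ⟨h.1, by omega, by omega⟩
    exact h3.reachable.trans ((h2.mono (Γ.outside_anti b (by omega))).trans h4.reachable)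
  have hlev : ∀ x, Γ.dist b (σ (π x)) = Γ.dist b x := fun x => ((hr _ _).1 (hσ (π x))).1
  set P : Q → Q := fun q => π (par (σ q)) with hP
  have hPadj : ∀ x y, Γ.Adj x y → Γ.dist b y + 1 = Γ.dist b x → P (π x) = π y := fun x y h h' =>
    hparent x y (σ (π x)) (hσ _).symm h h'
  have htree := isTree_fromRel_parent (fun q => Γ.dist b (σ q)) P (π b)
    (fun q hq => by
      rw [← hσ q, ← hΓ.dist_eq_zero_iff.1 hq])
    (fun q hq => by
      simp only [hP, hlev]
      rcases hpar (σ q) with h | h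
      · exact absurd h.1 hq
      · exact h.2)
    (fun q hq => by
      rcases hpar (σ q) with h | h
      · simp only [hP, h.2, hσ q]
      · omega)
  set H := fromRel fun a b => P a = b with hH
  refine ⟨H, htree, ?_, ?_⟩
  · have key : ∀ x y (w : Γ.Walk x y), H.dist (π x) (π y) ≤ w.length := by
      intro x y w
      induction w with
      | nil => simp
      | @cons x x' y h w ih =>
        have h1 : π x = π x' ∨ H.Adj (π x) (π x') := by
          by_cases hne : π x = π x'
          · exact Or.inl hne
          refine Or.inr ((fromRel_adj _ _ _).2 ⟨hne, ?_⟩)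
          have h2 := hΓ.dist_triangle (u := b) (v := x) (w := x')
          have h3 := hΓ.dist_triangle (u := b) (v := x') (w := x)
          rw [dist_eq_one_iff_adj.2 h] at h2
          rw [dist_eq_one_iff_adj.2 h.symm] at h3
          rcases Nat.lt_trichotomy (Γ.dist b x) (Γ.dist b x') with h4 | h4 | h4
          · exact Or.inr (hPadj _ _ h.symm (by omega))
          · exact absurd (hadj _ _ h h4) hne
          · exact Or.inl (hPadj _ _ h (by omega))
        rw [Walk.length_cons]
        rcases h1 with h1 | h1
        · rw [h1]
          omega
        · have := htree.connected.dist_triangle (u := π x) (v := π x') (w := π y)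
          rw [dist_eq_one_iff_adj.2 h1] at this
          omega
    intro x y
    obtain ⟨w, hw⟩ := hΓ.exists_walk_length_eq_dist x y
    exact hw ▸ key x y w
  -- Here `n` is the lowest level met by `w`, which has to descend to it from `x` and climb from it
  -- to `y`. The ancestors of `x` and `y` at level `n` then lie in one class, so at distance at most
  -- `D`.
  · have key : ∀ p q (w : H.Walk p q) x y, π x = p → π y = q → ∃ n, n ≤ Γ.dist b x ∧
        n ≤ Γ.dist b y ∧ (Γ.outside b n).Reachable x y ∧
        Γ.dist b x + Γ.dist b y ≤ 2 * n + w.length := by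
      intro p q w
      induction w with
      | nil =>
        rintro x y hx hy
        obtain ⟨h1, h2⟩ := (hr x y).1 (hx.trans hy.symm)
        exact ⟨_, le_rfl, h1.le, h2, by rw [Walk.length_nil]; omega⟩
      | @cons p p' q h w ih =>
        rintro x y hx hy
        rw [hH, fromRel_adj] at h
        obtain ⟨hne, h | h⟩ := h
        · obtain ⟨n, h1, h2, h3, h4⟩ := ih (par (σ p)) y h hy
          obtain ⟨h5, h6⟩ := (hr x (σ p)).1 (hx.trans (hσ p).symm)
          rcases hpar (σ p) with h7 | h7
          · exact absurd ((hσ p).symm.trans ((congrArg π h7.2.symm).trans h)) hne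
          have h8 : (Γ.outside b n).Adj (σ p) (par (σ p)) := ⟨h7.1, by omega, by omega⟩
          refine ⟨n, by omega, h2, ?_, by rw [Walk.length_cons]; omega⟩
          exact (h6.mono (Γ.outside_anti b (by omega))).trans (h8.reachable.trans h3)
        · obtain ⟨n, h1, h2, h3, h4⟩ := ih (σ p') y (hσ p') hy
          rcases hpar (σ p') with h7 | h7
          · exact absurd ((by rw [← h, hP]; simp only [h7.2, hσ p'])) hne
          obtain ⟨h5, h6⟩ := (hr x (par (σ p'))).1 (hx.trans h.symm)
          have h8 : (Γ.outside b (min n (Γ.dist b x))).Adj (par (σ p')) (σ p') :=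
            ⟨h7.1.symm, by omega, by omega⟩
          refine ⟨min n (Γ.dist b x), by omega, by omega, ?_, by rw [Walk.length_cons]; omega⟩
          exact (h6.mono (Γ.outside_anti b (by omega))).trans
            (h8.reachable.trans (h3.mono (Γ.outside_anti b (by omega))))
    intro x y
    obtain ⟨w, hw⟩ := htree.connected.exists_walk_length_eq_dist (π x) (π y)
    obtain ⟨n, h1, h2, h3, h4⟩ := key _ _ w x y rfl rfl
    obtain ⟨x', hx1, hx2, hx3⟩ :=
      hΓ.exists_ancestor (b := b) (n := n) (Γ.dist b x - n) x (by omega)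
    obtain ⟨y', hy1, hy2, hy3⟩ :=
      hΓ.exists_ancestor (b := b) (n := n) (Γ.dist b y - n) y (by omega)
    have h5 := hD x' y' (hx1.trans hy1.symm) (hx1 ▸ hx3.symm.trans (h3.trans hy3))
    have h6 := hΓ.dist_triangle (u := x) (v := x') (w := y)
    have h7 := hΓ.dist_triangle (u := x') (v := y') (w := y)
    rw [dist_comm (u := y') (v := y)] at h7
    omega

/-- A graph that is quasi-isometric to a tree is roughly isometric to a tree. -/
theorem exists_tree_of_coarse_map [Nonempty X] {V : Type u} {T : SimpleGraph V} (hT : T.IsTree)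
    (ψ : X → V) {E K : ℕ} (hE : ∀ x y, Γ.Adj x y → T.dist (ψ x) (ψ y) ≤ E)
    (hK : ∀ v, ∃ x, T.dist (ψ x) v ≤ K)
    (hadj : ∀ x y, T.dist (ψ x) (ψ y) ≤ 2 * K + 1 → x = y ∨ Γ.Adj x y) :
    ∃ (Q : Type u) (H : SimpleGraph Q) (π : X → Q) (D : ℕ), H.IsTree ∧ Function.Surjective π ∧
      (∀ x y, H.dist (π x) (π y) ≤ Γ.dist x y) ∧
      (∀ x y, Γ.dist x y ≤ H.dist (π x) (π y) + D) ∧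
      (Countable V → Countable Q) ∧
      ((∀ v, (T.neighborSet v).Finite) → ∀ q, (H.neighborSet q).Finite) := by
  classical
  obtain ⟨b⟩ := ‹Nonempty X›
  have hTc := hT.connected
  obtain ⟨hΓ, hdist⟩ := connected_and_dist_le hTc hK hadj
  have hdist' : ∀ x y, T.dist (ψ x) (ψ y) ≤ E * Γ.dist x y := dist_le_mul_dist hTc hΓ hE
  -- Let `m` be the median of the images of `b`, `x`, `y`. The outer walk has a point `c` over the
  -- `E`-ball of `m`, and the geodesics from `b` to `x` and `y` have such points `a`, `a'`. As `a`
  -- is within `2 * E + 1` of `c`, which is at least as far from `b` as `x`, it is as close to `x`;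
  -- likewise `a'` to `y`. The legs `x a`, `a a'`, `a' y` give the factor 3.
  have hD : ∀ x y, Γ.dist b x = Γ.dist b y → (Γ.outside b (Γ.dist b x)).Reachable x y →
      Γ.dist x y ≤ 3 * (2 * E + 1) := by
    rintro x y hxy ⟨w⟩
    obtain ⟨p⟩ := hTc.preconnected (ψ b) (ψ x)
    obtain ⟨m, hm1, hm2, hm3⟩ := hT.isAcyclic.exists_median p (ψ y)
    obtain ⟨c, hc, hcm⟩ := hm3.exists_dist_le hTc (Γ := Γ.outside b (Γ.dist b x)) (ψ := ψ)
      (fun _ _ h => hE _ _ h.1) w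
    have hc' := Γ.le_dist_of_mem_support_outside b w le_rfl hc
    have near : ∀ z, Γ.dist b z = Γ.dist b x → T.Separates m (ψ b) (ψ z) →
        ∃ a, Γ.dist a z ≤ 2 * E + 1 ∧ T.dist (ψ a) m ≤ E := by
      intro z hz hs
      obtain ⟨r, hr⟩ := hΓ.exists_walk_length_eq_dist b z
      obtain ⟨a, ha, ham⟩ := hs.exists_dist_le hTc hE r
      refine ⟨a, ?_, ham⟩
      have h1 := r.dist_add_dist_of_mem_support hΓ hr ha
      have h2 := hdist a c
      have h3 := hTc.dist_triangle (u := ψ a) (v := m) (w := ψ c)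
      rw [dist_comm (u := m)] at h3
      have h4 := hΓ.dist_triangle (u := b) (v := a) (w := c)
      omega
    obtain ⟨a, ha, ham⟩ := near x rfl hm1
    obtain ⟨a', ha', ham'⟩ := near y hxy.symm hm2
    have h2 := hdist a a'
    have h3 := hTc.dist_triangle (u := ψ a) (v := m) (w := ψ a')
    rw [dist_comm (u := m)] at h3
    have h5 := hΓ.dist_triangle (u := x) (v := a) (w := y)
    have h6 := hΓ.dist_triangle (u := a) (v := a') (w := y)
    rw [dist_comm (u := x) (v := a)] at h5
    omega
  -- Points with the same image under `ψ` are equal or adjacent, so level and image determine the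
  -- class. This injection serves for smallness, countability and local finiteness.
  let ι : Quotient (Γ.levelSetoid b) → ℕ × V := fun q => (Γ.dist b q.out, ψ q.out)
  have hinj : ∀ x y, Γ.dist b x = Γ.dist b y → ψ x = ψ y → Γ.levelSetoid b x y := by
    intro x y h h'
    refine ⟨h, ?_⟩
    obtain rfl | h'' := hadj x y (by simp [h'])
    · exact .rfl
    · exact Adj.reachable ⟨h'', le_rfl, h.le⟩
  have hι : Function.Injective ι := by
    intro p q h
    rw [← p.out_eq, ← q.out_eq]
    exact Quotient.sound (hinj _ _ (congrArg Prod.fst h) (congrArg Prod.snd h))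
  have : Small.{u} (Quotient (Γ.levelSetoid b)) := small_of_injective hι
  let e := equivShrink.{u} (Quotient (Γ.levelSetoid b))
  let π : X → Shrink.{u} (Quotient (Γ.levelSetoid b)) := fun x => e (Quotient.mk _ x)
  have hπ : Function.Surjective π := e.surjective.comp Quotient.mk_surjective
  have hr : ∀ x y, π x = π y ↔ Γ.levelSetoid b x y := fun x y =>
    e.injective.eq_iff.trans Quotient.eq
  obtain ⟨H, hH, h1, h2⟩ := hΓ.exists_tree_of_levels hD π hπ hr
  refine ⟨_, H, π, _, hH, hπ, h1, h2, fun _ => (hι.comp e.symm.injective).countable, ?_⟩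
  intro hf q
  obtain ⟨x, rfl⟩ := hπ q
  -- Representatives of adjacent classes are within one plus the diameter bound `3 * (2 * E + 1)`.
  have hfin : (Set.Iic (Γ.dist b x + (1 + 3 * (2 * E + 1))) ×ˢ
      {a | T.dist (ψ x) a ≤ E * (1 + 3 * (2 * E + 1))}).Finite :=
    (Set.finite_Iic _).prod (finite_dist_le hTc hf _ _)
  refine Set.Finite.of_injOn (f := fun q => ι (e.symm q)) ?_
    (hι.comp e.symm.injective).injOn hfin
  intro p hp
  have h3 : π (e.symm p).out = p := by simp [π]
  have h4 := h2 x (e.symm p).out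
  rw [h3, dist_eq_one_iff_adj.2 hp] at h4
  refine ⟨?_, ?_⟩
  · have h5 := hΓ.dist_triangle (u := b) (v := x) (w := (e.symm p).out)
    exact h5.trans (by omega)
  · exact (hdist' _ _).trans (Nat.mul_le_mul_left _ h4)

end SimpleGraph

/-! ### The path metric on vertices. -/

namespace SimplicialTree

variable {T : SimplicialTree.{u}}

/-- The affine extension of the distance to the vertex `v`. -/
noncomputable def distTo (v : T.V) (p : T.Point) : ℝ :=
  p.coord.sum fun w a => a * T.graph.dist w v

theorem distTo_vertex (v w : T.V) : distTo v (T.vertex w) = T.graph.dist w v := by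
  simp [distTo, vertex]

theorem OnEdge.distTo_eq {u v : T.V} {p : T.Point} (h : T.OnEdge u v p) (w : T.V) :
    distTo w p = p.coord u * T.graph.dist u w + p.coord v * T.graph.dist v w := by
  classical
  have hs : p.coord.support ⊆ {u, v} := by
    intro w hw
    simpa using h.2 w (Finsupp.mem_support_iff.1 hw)
  rw [distTo, Finsupp.sum_of_support_subset _ hs _ (by simp), Finset.sum_pair h.1.ne]

/-- On each edge `distTo w` is affine with slope at most 1 in absolute value. This bounds the path
metric from below by the graph distance. -/
theorem HasPath.abs_distTo_sub_le {p q : T.Point} {l : ℝ} (h : T.HasPath p q l) (w : T.V) :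
    |distTo w p - distTo w q| ≤ l := by
  induction h with
  | nil p => simp
  | @cons p q r u v l hp hq _ ih =>
    refine (_root_.abs_sub_le _ _ _).trans (add_le_add ?_ ih)
    have h1 := hp.add_eq_one
    have h2 := hq.add_eq_one
    have h3 : distTo w p - distTo w q =
        (p.coord u - q.coord u) * (T.graph.dist u w - T.graph.dist v w) := by
      rw [hp.distTo_eq, hq.distTo_eq, eq_sub_of_add_eq' h1, eq_sub_of_add_eq' h2]
      ring
    have h4 := T.isTree.connected.dist_triangle (u := u) (v := v) (w := w)
    have h5 := T.isTree.connected.dist_triangle (u := v) (v := u) (w := w)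
    rw [SimpleGraph.dist_eq_one_iff_adj.2 hp.1] at h4
    rw [SimpleGraph.dist_eq_one_iff_adj.2 hp.1.symm] at h5
    have h6 : |(T.graph.dist u w : ℝ) - T.graph.dist v w| ≤ 1 := by
      rw [abs_le]
      constructor
      · linarith [show (T.graph.dist v w : ℝ) ≤ 1 + T.graph.dist u w by exact_mod_cast h5]
      · linarith [show (T.graph.dist u w : ℝ) ≤ 1 + T.graph.dist v w by exact_mod_cast h4]
    rw [h3, abs_mul]
    exact mul_le_of_le_one_right (abs_nonneg _) h6

theorem hasPath_vertex_of_walk {u v : T.V} (p : T.graph.Walk u v) :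
    T.HasPath (T.vertex u) (T.vertex v) p.length := by
  classical
  induction p with
  | nil => simpa using HasPath.nil _
  | @cons u u' v h p ih =>
    have := HasPath.cons (onEdge_vertex_left h) (onEdge_vertex_left h.symm).swap ih
    convert this using 1
    simp [vertex, h.ne', add_comm]

theorem dist_vertex (v w : T.V) : dist (T.vertex v) (T.vertex w) = T.graph.dist v w := by
  apply le_antisymm
  · obtain ⟨p, hp⟩ := T.isTree.connected.exists_walk_length_eq_dist v w
    exact hp ▸ pathDist_le (hasPath_vertex_of_walk p)
  · refine le_pathDist fun l hl => ?_
    have := (le_abs_self _).trans (hl.abs_distTo_sub_le w)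
    simpa [distTo_vertex] using this

theorem exists_dist_vertex_le_one (p : T.Point) : ∃ v, dist p (T.vertex v) ≤ 1 := by
  classical
  obtain ⟨u, v, huv | huv, h⟩ := p.mem_cell
  · subst huv
    have hs : p.coord.support ⊆ {u} := by
      intro w hw
      simpa using h w (Finsupp.mem_support_iff.1 hw)
    obtain ⟨a, ha⟩ := Finsupp.support_subset_singleton'.1 hs
    have h1 := p.sum_eq_one
    rw [ha, Finsupp.sum_single_index rfl] at h1
    have hp : p = T.vertex u := by
      ext1
      rw [ha, h1]
      rfl
    exact ⟨u, by simp [hp]⟩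
  · have hp : T.OnEdge u v p := ⟨huv, h⟩
    have hu := onEdge_vertex_left huv
    have h1 := hp.add_eq_one
    have h2 := p.nonneg u
    have h3 := p.nonneg v
    refine ⟨u, (pathDist_le (.cons hp hu (.nil _))).trans ?_⟩
    have h4 : (T.vertex u).coord u = 1 := by simp [vertex]
    rw [h4, add_zero, abs_le]
    constructor <;> linarith

end SimplicialTree

/-! ### Rough actions from left-invariant distances. -/

section QuasiAction

variable {G : Type*} [Group G]

/-- A group acts by rough isometries on a space that is roughly isometric to the group with a
left-invariant distance. -/
theorem isQuasiAction_of_leftInvariant {Y : Type*} [MetricSpace Y] {δ : G → G → ℝ}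
    (hδ : ∀ g x y, δ (g * x) (g * y) = δ x y) {θ : G → Y} {τ : Y → G} {D : ℝ}
    (hθ : ∀ x y, |dist (θ x) (θ y) - δ x y| ≤ D) (hτ : ∀ p, dist (θ (τ p)) p ≤ D) :
    IsQuasiAction 1 (4 * D) fun g p => θ (g * τ p) := by
  have hθ1 : ∀ x y, dist (θ x) (θ y) ≤ δ x y + D := fun x y => by
    linarith [(abs_le.1 (hθ x y)).2]
  have hθ2 : ∀ x y, δ x y ≤ dist (θ x) (θ y) + D := fun x y => by
    linarith [(abs_le.1 (hθ x y)).1]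
  have hD : 0 ≤ D := (abs_nonneg _).trans (hθ 1 1)
  refine ⟨fun g => ⟨le_rfl, by positivity, fun p q => ?_, fun p q => ?_, fun p => ?_⟩,
    fun g h p => ?_⟩
  -- Two comparisons of `θ` with `δ` and two roundings by `τ` cost `D` each.
  · have h1 := hθ2 (g * τ p) (g * τ q)
    rw [hδ] at h1
    linarith [hθ1 (τ p) (τ q), dist_triangle4 p (θ (τ p)) (θ (τ q)) q, hτ p, hτ q,
      dist_comm p (θ (τ p))]
  · have h1 := hθ1 (g * τ p) (g * τ q)
    rw [hδ] at h1
    linarith [hθ2 (τ p) (τ q), dist_triangle4 (θ (τ p)) p q (θ (τ q)), hτ p, hτ q,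
      dist_comm q (θ (τ q))]
  · refine ⟨θ (g⁻¹ * τ p), ?_⟩
    have h1 := hθ1 (g * τ (θ (g⁻¹ * τ p))) (g * (g⁻¹ * τ p))
    rw [hδ, mul_inv_cancel_left] at h1
    linarith [hθ2 (τ (θ (g⁻¹ * τ p))) (g⁻¹ * τ p), hτ (θ (g⁻¹ * τ p)), hτ p,
      dist_triangle (θ (g * τ (θ (g⁻¹ * τ p)))) (θ (τ p)) p]
  · have h1 := hθ1 (g * τ (θ (h * τ p))) (g * (h * τ p))
    rw [hδ, ← mul_assoc] at h1
    linarith [hθ2 (τ (θ (h * τ p))) (h * τ p), hτ (θ (h * τ p))]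

namespace IsQuasiAction

variable {X : Type*} [MetricSpace X] {L C : ℝ} {A : G → X → X}

/-- `A g` sends `x` to `A g x` exactly and `A (g⁻¹ * h) x` to within `C` of `A h x`; the other `C`
is the quasi-isometry error. -/
theorem dist_orbit_le (hA : IsQuasiAction L C A) (x : X) (g h : G) :
    dist (A g x) (A h x) ≤ L * dist (A (g⁻¹ * h) x) x + 2 * C := by
  have h1 := hA.almost_mul g (g⁻¹ * h) x
  rw [mul_inv_cancel_left] at h1
  have h2 := (hA.isQuasiIsometry g).upper (A (g⁻¹ * h) x) x
  linarith [dist_triangle (A h x) (A g (A (g⁻¹ * h) x)) (A g x), dist_comm (A g x) (A h x),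
    dist_comm (A h x) (A g (A (g⁻¹ * h) x))]

theorem dist_le_orbit (hA : IsQuasiAction L C A) (x : X) (g h : G) :
    dist (A (g⁻¹ * h) x) x ≤ L * (dist (A g x) (A h x) + 2 * C) := by
  have h1 := hA.almost_mul g (g⁻¹ * h) x
  rw [mul_inv_cancel_left] at h1
  have h2 := (hA.isQuasiIsometry g).lower (A (g⁻¹ * h) x) x
  have h3 : 0 < L := one_pos.trans_le (hA.isQuasiIsometry g).one_le
  have h4 : 1 / L * dist (A (g⁻¹ * h) x) x ≤ dist (A g x) (A h x) + 2 * C := by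
    linarith [dist_triangle (A g (A (g⁻¹ * h) x)) (A h x) (A g x), dist_comm (A g x) (A h x)]
  rwa [one_div, inv_mul_le_iff₀ h3] at h4

/-- A quasi-action is quasi-conjugate to the left translation action on the group with a
left-invariant distance for which the orbit map is a quasi-isometry. -/
theorem areQuasiConjugate_of_leftInvariant (hA : IsQuasiAction L C A) (hcb : IsCobounded A)
    {Y : Type*} [MetricSpace Y] {δ : G → G → ℝ} (hδ : ∀ g x y, δ (g * x) (g * y) = δ x y)
    {θ : G → Y} {τ : Y → G} {D : ℝ} (hθ : ∀ x y, |dist (θ x) (θ y) - δ x y| ≤ D)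
    (hτ : ∀ p, dist (θ (τ p)) p ≤ D) (x₀ : X) {M : ℝ} (hM : 1 ≤ M)
    (h1 : ∀ g h, dist (A g x₀) (A h x₀) ≤ M * δ g h + M)
    (h2 : ∀ g h, δ g h ≤ M * dist (A g x₀) (A h x₀) + M) :
    AreQuasiConjugate A fun g p => θ (g * τ p) := by
  have hθ1 : ∀ x y, dist (θ x) (θ y) ≤ δ x y + D := fun x y => by
    linarith [(abs_le.1 (hθ x y)).2]
  have hθ2 : ∀ x y, δ x y ≤ dist (θ x) (θ y) + D := fun x y => by
    linarith [(abs_le.1 (hθ x y)).1]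
  have hD : 0 ≤ D := (abs_nonneg _).trans (hθ 1 1)
  have hC : 0 ≤ C := (hA.isQuasiIsometry 1).nonneg
  have hL : 1 ≤ L := (hA.isQuasiIsometry 1).one_le
  obtain ⟨K, hK, hγ⟩ := hcb
  -- `γ` is a coarse inverse of the orbit map, and `θ ∘ γ` will be the conjugating map.
  choose γ hγ using fun x => hγ x₀ x
  have hM0 : 0 < M := one_pos.trans_le hM
  have hγ1 : ∀ g p, δ (γ p) g ≤ M * (K + dist p (A g x₀)) + M := fun g p => by
    have h3 : dist (A (γ p) x₀) (A g x₀) ≤ K + dist p (A g x₀) :=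
      (dist_triangle _ p _).trans (add_le_add_left (hγ p) _)
    exact (h2 _ _).trans (add_le_add_left (mul_le_mul_of_nonneg_left h3 hM0.le) _)
  refine ⟨fun p => θ (γ p), ⟨M, M * (2 * K + 2) + D + D + K + K,
    hM, by positivity, fun p q => ?_, fun p q => ?_, fun y => ?_⟩,
    M * (K + (K + (L * K + C) + C)) + M + D + (D + D + D), by positivity, fun p g => ?_⟩
  · have h3 := h1 (γ p) (γ q)
    have h4 := hθ2 (γ p) (γ q)
    have h5 : dist p q ≤ M * (dist (θ (γ p)) (θ (γ q)) + D) + M + 2 * K := by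
      have h6 := mul_le_mul_of_nonneg_left h4 hM0.le
      linarith [dist_triangle4 p (A (γ p) x₀) (A (γ q) x₀) q, hγ p, hγ q,
        dist_comm p (A (γ p) x₀)]
    have h6 : 1 / M * dist p q ≤ dist (θ (γ p)) (θ (γ q)) + D + 1 + 1 / M * (2 * K) := by
      rw [one_div, inv_mul_le_iff₀ hM0]
      have : M * (M⁻¹ * (2 * K)) = 2 * K := by rw [mul_inv_cancel_left₀ hM0.ne']
      rw [mul_add]
      linarith
    have h7 : 1 / M * (2 * K) ≤ 2 * K :=
      mul_le_of_le_one_left (by positivity) ((div_le_one hM0).2 hM)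
    have h8 : 2 * K + 2 ≤ M * (2 * K + 2) := le_mul_of_one_le_left (by positivity) hM
    linarith
  · have h3 := hγ1 (γ q) p
    have h4 := mul_le_mul_of_nonneg_left (dist_triangle p q (A (γ q) x₀)) hM0.le
    have h5 := mul_le_mul_of_nonneg_left (hγ q) hM0.le
    rw [dist_comm] at h5
    linarith [hθ1 (γ p) (γ q)]
  · refine ⟨A (τ y) x₀, ?_⟩
    have h3 := hγ1 (τ y) (A (τ y) x₀)
    rw [dist_self, add_zero] at h3
    have h4 := mul_nonneg hM0.le hK
    linarith [hθ1 (γ (A (τ y) x₀)) (τ y), hτ y, dist_triangle (θ (γ (A (τ y) x₀))) (θ (τ y)) y]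
  · have h3 := hγ1 (g * γ p) (A g p)
    have h4 := hA.almost_mul g (γ p) x₀
    have h5 := (hA.isQuasiIsometry g).upper p (A (γ p) x₀)
    have h6 : dist p (A (γ p) x₀) ≤ K := by rw [dist_comm]; exact hγ p
    have h7 := mul_le_mul_of_nonneg_left h6 (zero_le_one.trans hL)
    have h8 : dist (A g p) (A (g * γ p) x₀) ≤ K + (L * K + C) + C := by
      linarith [dist_triangle (A g p) (A g (A (γ p) x₀)) (A (g * γ p) x₀)]
    have h9 := mul_le_mul_of_nonneg_left (add_le_add_right h8 K) hM0.le
    have h10 := hθ1 (g * γ p) (g * τ (θ (γ p)))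
    rw [hδ] at h10
    have h11 := hθ2 (γ p) (τ (θ (γ p)))
    have h12 := hτ (θ (γ p))
    rw [dist_comm] at h12
    change dist (θ (γ (A g p))) (θ (g * τ (θ (γ p)))) ≤ _
    linarith [hθ1 (γ (A g p)) (g * γ p),
      dist_triangle (θ (γ (A g p))) (θ (g * γ p)) (θ (g * τ (θ (γ p))))]

end IsQuasiAction

end QuasiAction

/-! ### The invariant graph on the group and the conclusion. -/

theorem SimpleGraph.Connected.dist_map_le {X Y : Type*} {Γ : SimpleGraph X} {Γ' : SimpleGraph Y}
    (h : Γ.Connected) (f : Γ →g Γ') (x y : X) : Γ'.dist (f x) (f y) ≤ Γ.dist x y := by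
  obtain ⟨w, hw⟩ := h.exists_walk_length_eq_dist x y
  rw [← hw, ← w.length_map f]
  exact SimpleGraph.dist_le _

/-- A cobounded quasi-action on a tree is quasi-conjugate to an action up to bounded error by rough
isometries on a tree, which inherits countability and local finiteness. -/
theorem IsQuasiAction.exists_rough_action {G : Type w} [Group G] {T : SimplicialTree.{u}} {L C : ℝ}
    {A : G → T.Point → T.Point} (hA : IsQuasiAction L C A) (hcb : IsCobounded A) :
    ∃ T' : SimplicialTree.{u}, (T.IsCountable → T'.IsCountable) ∧
      (T.IsLocallyFinite → T'.IsLocallyFinite) ∧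
      ∃ (C' : ℝ) (A' : G → T'.Point → T'.Point),
        IsQuasiAction 1 C' A' ∧ AreQuasiConjugate A A' := by
  have hC : 0 ≤ C := (hA.isQuasiIsometry 1).nonneg
  have hL : 1 ≤ L := (hA.isQuasiIsometry 1).one_le
  have hTc := T.isTree.connected
  obtain ⟨v₀⟩ := hTc.nonempty
  set x₀ := T.vertex v₀
  obtain ⟨κ, hκ, hcob⟩ := id hcb
  choose ψ hψ using fun g => SimplicialTree.exists_dist_vertex_le_one (A g x₀)
  have hψ1 : ∀ g h, (T.graph.dist (ψ g) (ψ h) : ℝ) ≤ dist (A g x₀) (A h x₀) + 2 := fun g h => by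
    rw [← SimplicialTree.dist_vertex]
    linarith [dist_triangle4 (T.vertex (ψ g)) (A g x₀) (A h x₀) (T.vertex (ψ h)), hψ g, hψ h,
      dist_comm (T.vertex (ψ g)) (A g x₀)]
  have hψ2 : ∀ g h, dist (A g x₀) (A h x₀) ≤ T.graph.dist (ψ g) (ψ h) + 2 := fun g h => by
    rw [← SimplicialTree.dist_vertex]
    linarith [dist_triangle4 (A g x₀) (T.vertex (ψ g)) (T.vertex (ψ h)) (A h x₀), hψ g, hψ h,
      dist_comm (T.vertex (ψ h)) (A h x₀)]
  -- The 1 pays for rounding to a vertex. `R` is what `dist_le_orbit` yields when the rounded orbit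
  -- points are within `2 * K + 1`, and `E` bounds the stretch of an edge by `dist_orbit_le`, plus
  -- two roundings.
  obtain ⟨K, hK⟩ := exists_nat_ge (κ + 1)
  set R := L * (2 * K + 3 + 2 * C) with hR
  obtain ⟨E, hE⟩ := exists_nat_ge (L * R + 2 * C + 2)
  set Γ : SimpleGraph G := SimpleGraph.fromRel fun g h => dist (A (g⁻¹ * h) x₀) x₀ ≤ R with hΓ
  have hEadj : ∀ g h, Γ.Adj g h → T.graph.dist (ψ g) (ψ h) ≤ E := by
    have key : ∀ g h, dist (A (g⁻¹ * h) x₀) x₀ ≤ R → T.graph.dist (ψ g) (ψ h) ≤ E := by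
      intro g h hgh
      have h1 := mul_le_mul_of_nonneg_left hgh (zero_le_one.trans hL)
      have h2 : (T.graph.dist (ψ g) (ψ h) : ℝ) ≤ E := by
        linarith [hψ1 g h, hA.dist_orbit_le x₀ g h]
      exact_mod_cast h2
    intro g h hgh
    rw [hΓ, SimpleGraph.fromRel_adj] at hgh
    obtain ⟨-, hgh | hgh⟩ := hgh
    · exact key g h hgh
    · rw [SimpleGraph.dist_comm]
      exact key h g hgh
  have hdense : ∀ v, ∃ g, T.graph.dist (ψ g) v ≤ K := fun v => by
    obtain ⟨g, hg⟩ := hcob x₀ (T.vertex v)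
    refine ⟨g, ?_⟩
    have : (T.graph.dist (ψ g) v : ℝ) ≤ K := by
      rw [← SimplicialTree.dist_vertex]
      linarith [dist_triangle (T.vertex (ψ g)) (A g x₀) (T.vertex v), hψ g,
        dist_comm (T.vertex (ψ g)) (A g x₀)]
    exact_mod_cast this
  have hadj : ∀ g h, T.graph.dist (ψ g) (ψ h) ≤ 2 * K + 1 → g = h ∨ Γ.Adj g h := by
    intro g h hgh
    refine or_iff_not_imp_left.2 fun hne => (SimpleGraph.fromRel_adj _ _ _).2 ⟨hne, Or.inl ?_⟩
    have h1 : (T.graph.dist (ψ g) (ψ h) : ℝ) ≤ 2 * K + 1 := by exact_mod_cast hgh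
    refine (hA.dist_le_orbit x₀ g h).trans ?_
    exact mul_le_mul_of_nonneg_left (by linarith [hψ2 g h]) (zero_le_one.trans hL)
  obtain ⟨hΓc, hdist⟩ := SimpleGraph.connected_and_dist_le hTc hdense hadj
  have hdist' := SimpleGraph.dist_le_mul_dist hTc hΓc hEadj
  obtain ⟨Q, H, π, D, hH, hπ, h1, h2, hcount, hfin⟩ :=
    SimpleGraph.exists_tree_of_coarse_map T.isTree ψ hEadj hdense hadj
  let T' : SimplicialTree.{u} := ⟨Q, H, hH⟩
  have hinv : ∀ g x y : G, (Γ.dist (g * x) (g * y) : ℝ) = Γ.dist x y := by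
    have key : ∀ g x y : G, Γ.dist (g * x) (g * y) ≤ Γ.dist x y := fun g =>
      hΓc.dist_map_le ⟨fun x => g * x, fun {x y} h => by
        rw [hΓ, SimpleGraph.fromRel_adj] at h ⊢
        simpa [mul_assoc] using h⟩
    intro g x y
    have := key g⁻¹ (g * x) (g * y)
    rw [inv_mul_cancel_left, inv_mul_cancel_left] at this
    exact_mod_cast (key g x y).antisymm this
  -- Rounding to a vertex costs 1 and comparing the tree with `Γ` costs `D`; `D + 1` covers both.
  have hτ : ∀ p : T'.Point, ∃ g, dist (T'.vertex (π g)) p ≤ D + 1 := fun p => by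
    obtain ⟨q, hq⟩ := SimplicialTree.exists_dist_vertex_le_one p
    obtain ⟨g, rfl⟩ := hπ q
    refine ⟨g, ?_⟩
    rw [dist_comm]
    exact hq.trans (by simp)
  choose τ hτ using hτ
  have hθ : ∀ x y, |dist (T'.vertex (π x)) (T'.vertex (π y)) - (Γ.dist x y : ℝ)| ≤ D + 1 := by
    intro x y
    rw [SimplicialTree.dist_vertex, abs_le]
    have h3 : (H.dist (π x) (π y) : ℝ) ≤ Γ.dist x y := by exact_mod_cast h1 x y
    have h4 : (Γ.dist x y : ℝ) ≤ H.dist (π x) (π y) + D := by exact_mod_cast h2 x y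
    have h5 : (0 : ℝ) ≤ D := D.cast_nonneg
    change -((D : ℝ) + 1) ≤ (H.dist (π x) (π y) : ℝ) - Γ.dist x y ∧
      (H.dist (π x) (π y) : ℝ) - Γ.dist x y ≤ D + 1
    constructor <;> linarith
  have hE0 : (0 : ℝ) ≤ E := E.cast_nonneg
  refine ⟨T', hcount, hfin, _, _, isQuasiAction_of_leftInvariant hinv hθ hτ,
    hA.areQuasiConjugate_of_leftInvariant hcb hinv hθ hτ x₀ (M := E + 3) (by linarith)
      (fun g h => ?_) (fun g h => ?_)⟩
  · have h3 : (T.graph.dist (ψ g) (ψ h) : ℝ) ≤ E * Γ.dist g h := by exact_mod_cast hdist' g h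
    have h4 : (0 : ℝ) ≤ Γ.dist g h := Nat.cast_nonneg _
    linarith [hψ2 g h]
  · have h3 : (Γ.dist g h : ℝ) ≤ T.graph.dist (ψ g) (ψ h) + 1 := by exact_mod_cast hdist g h
    have h4 : dist (A g x₀) (A h x₀) ≤ (E + 3) * dist (A g x₀) (A h x₀) :=
      le_mul_of_one_le_left dist_nonneg (by linarith)
    linarith [hψ1 g h]

theorem mainTheorem9 (G : Type w) [Group G] [Group.FG G] :
    (∀ T : SimplicialTree.{u}, T.IsCountable →
      ∀ (L C : ℝ) (A : G → T.Point → T.Point), IsQuasiAction L C A → IsCobounded A →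
        ∃ T' : SimplicialTree.{u}, T'.IsCountable ∧
          ∃ (C' : ℝ) (A' : G → T'.Point → T'.Point),
            IsQuasiAction 1 C' A' ∧ AreQuasiConjugate A A') ∧
    (∀ T : SimplicialTree.{u}, T.IsLocallyFinite →
      ∀ (L C : ℝ) (A : G → T.Point → T.Point), IsQuasiAction L C A → IsCobounded A →
        ∃ T' : SimplicialTree.{u}, T'.IsLocallyFinite ∧
          ∃ (C' : ℝ) (A' : G → T'.Point → T'.Point),
            IsQuasiAction 1 C' A' ∧ AreQuasiConjugate A A') := by
  constructor
  · intro T hT L C A hA hcb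
    obtain ⟨T', h1, -, h2⟩ := hA.exists_rough_action hcb
    exact ⟨T', h1 hT, h2⟩
  · intro T hT L C A hA hcb
    obtain ⟨T', -, h1, h2⟩ := hA.exists_rough_action hcb
    exact ⟨T', h1 hT, h2⟩
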